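/- Let $\mathcal R$ be a term rewrite system (TRS): a set of rewrite rules $l\to r$, i.e. pairs of terms over a signature and a set of variables, with no variable condition imposed. A rule is duplicating if some variable occurs more often in $r$ than in $l$; let $\mathcal R_{\mathsf d}$ and $\mathcal R_{\mathsf{nd}}$ be the sets of duplicating and non-duplicating rules of $\mathcal R$. Write $s\to^\pi t$ for a rewrite step of $\mathcal R$ with redex pattern $\pi=\langle p,\,l\to r,\,\tau\rangle$ (so $s|_p=l\tau$ and $t=s[r\tau]_p$); for a context $C$ with hole at position $q$ and a substitution $\sigma$ let $C[\pi\sigma]=\langle qp,\,l\to r,\,\tau\sigma\rangle$. Let $>$ and $\geqslant$ be relations on a set of labels, and let $\ell$ assign a label to every rewrite step, read forwards ($s\to^\pi t$) or backwards ($t\leftarrow^\pi s$). * $\ell$ is a *labeling* (for $>,\geqslant$) if $\ell(s\to^\pi t)=\ell(t\leftarrow^\pi s)$ always, and for all contexts $C$ and substitutions $\sigma$ and both choices of $\mathrel{\rhd}\in\{>,\geqslant\}$: $\ell(s\to^{\pi_1}t)\rhd\ell(u\to^{\pi_2}v)$ implies $\ell(C[s\sigma]\to^{C[\pi_1\sigma]}C[t\sigma])\rhd\ell(C[u\sigma]\to^{C[\pi_2\sigma]}C[v\sigma])$.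 * Consider a local peak $t\leftarrow^{\pi_1}s\to^{\pi_2}u$ with redex positions $p$ (of $\pi_1$) and $q$ (of $\pi_2$), rule $l_2\to r_2$ of $\pi_2$, and labels $\alpha=\ell(t\leftarrow^{\pi_1}s)$, $\beta=\ell(s\to^{\pi_2}u)$. It is a *parallel peak* if $p$ and $q$ are incomparable in the prefix order, and a *variable peak* if $p=qq'$ where $q'$ is not a function symbol position of $l_2$. * The peak is *extended locally decreasing* for $\ell$ if there are terms $t',t'',u'',u'$ with $t\leftrightarrow^* t'\to^= t''\leftrightarrow^* u''\mathrel{{}^={\leftarrow}}u'\leftrightarrow^* u$ in which the labels of the five parts are, respectively, $<\alpha$; $\leqslant\beta$; $<\alpha$ or $<\beta$; $\leqslant\alpha$; $<\beta$ (where $\to^=$ is at most one step, and $x<y$, $x\leqslant y$ mean $y>x$, $y\geqslant x$). * The peak is *weakly extended locally decreasing* for $\ell$ if there are a term $v$, a step $t\to v$ with label $\leqslant\beta$, and $n\ge 0$ steps $u\to^n v$ with labels $\leqslant\alpha$ (of these steps read backwards), where $n\leqslant 1$ if $r_2$ is linear. * $\ell$ is *compatible* (resp. *weakly compatible*) with $\mathcal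 R$ if all parallel peaks and all variable peaks of $\mathcal R$ are extended locally decreasing (resp. weakly extended locally decreasing) for $\ell$. The *source labeling* $\ell^{\mathsf{src}}$ labels a step $s\to^\pi t$ (in either reading) by its source $s$; its labels are compared by $>_{\mathsf{src}}\,:=\,\to^+_{\mathcal R_{\mathsf d}/\mathcal R_{\mathsf{nd}}}$ and $\geqslant_{\mathsf{src}}\,:=\,\to^*_{\mathcal R}$, where $\to_{\mathcal R_{\mathsf d}/\mathcal R_{\mathsf{nd}}}\,=\,\to^*_{\mathcal R_{\mathsf{nd}}}\cdot\to_{\mathcal R_{\mathsf d}}\cdot\to^*_{\mathcal R_{\mathsf{nd}}}$. The *lexicographic combination* $\ell^{\mathsf{src}}\times\ell$ labels a step by the pair of its two labels; pairs are compared by $$(a,b)>_{\mathsf{lex}}(a',b')\iff a>_{\mathsf{src}}a'\ \text{ or }\ (a\geqslant_{\mathsf{src}}a'\text{ and }b>b'),$$ $$(a,b)\geqslant_{\mathsf{lex}}(a',b')\iff a>_{\mathsf{src}}a'\ \text{ or }\ (a\geqslant_{\mathsf{src}}a'\text{ and }b\geqslant b').$$ **Lemma.** Let $\mathcal R$ be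 a left-linear TRS whose duplicating rules terminate relative to its other rules (that is, $\to_{\mathcal R_{\mathsf d}/\mathcal R_{\mathsf{nd}}}$ admits no infinite sequence), and let $\ell$ be a labeling for $>,\geqslant$ that is weakly compatible with $\mathcal R$. Then 1. $\ell^{\mathsf{src}}\times\ell$ is a labeling for $>_{\mathsf{lex}},\geqslant_{\mathsf{lex}}$; 2. $\ell^{\mathsf{src}}\times\ell$ is compatible with $\mathcal R$ for $>_{\mathsf{lex}},\geqslant_{\mathsf{lex}}$; 3. the required properties of the orders are preserved: if $>$ is a well-founded order, $\geqslant$ is a preorder, and ${\geqslant}\cdot{>}\cdot{\geqslant}\subseteq{>}$, then the same holds for $>_{\mathsf{lex}}$ and $\geqslant_{\mathsf{lex}}$. -/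

import Mathlib

universe u v w z

namespace TRS

/-! Terms over a signature `L` (only the function symbols of `L` matter) and a type `V` of
variables are Mathlib's `L.Term V`; substitutions are functions `V → L.Term V`, applied with
`FirstOrder.Language.Term.subst`. -/

variable {L : FirstOrder.Language.{u, v}} {V : Type w}

/-- A position is a list of argument indices, where the arguments of a function symbol of arity
`n` are numbered `0, …, n - 1`. -/
abbrev Position := List ℕ

/-- Two positions are parallel if neither is a prefix of the other. -/
def ParallelPos (p q : Position) : Prop := ¬ p <+: q ∧ ¬ q <+: p

/-- The subterm of a term at a position; `none` if it is not a position of the term. -/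
def subtermAt : L.Term V → Position → Option (L.Term V)
  | t, [] => some t
  | .var _, _ :: _ => none
  | .func (l := n) _ ts, i :: p => if h : i < n then subtermAt (ts ⟨i, h⟩) p else none

/-- The term `s[u]_p`, for a position `p` of `s` (and `s` itself if `p` is not one). -/
def replaceAt : L.Term V → Position → L.Term V → L.Term V
  | _, [], u => u
  | .var x, _ :: _, _ => .var x
  | .func f ts, i :: p, u =>
      .func f (fun j => if (j : ℕ) = i then replaceAt (ts j) p u else ts j)

/-- The set of function symbol positions of a term. -/
def funPos (t : L.Term V) : Set Position :=
  {p | ∃ (n : ℕ) (f : L.Functions n) (ts : Fin n → L.Term V), subtermAt t p = some (.func f ts)}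

open Classical in
/-- The number `|t|_x` of occurrences of the variable `x` in the term `t`. -/
noncomputable def occ (x : V) : L.Term V → ℕ
  | .var y => if y = x then 1 else 0
  | .func _ ts => ∑ i, occ x (ts i)

/-- A term is linear if every variable occurs at most once in it. -/
def LinearTerm (t : L.Term V) : Prop := ∀ x, occ x t ≤ 1

/-- Contexts: terms with exactly one hole. -/
inductive Context (L : FirstOrder.Language.{u, v}) (V : Type w) : Type (max u v w)
  | hole : Context L V
  | app {n : ℕ} (f : L.Functions n) (i : Fin n) (C : Context L V)
      (ts : {j : Fin n // j ≠ i} → L.Term V) : Context L V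

/-- The term `C[t]`. -/
def Context.fill : Context L V → L.Term V → L.Term V
  | .hole, t => t
  | .app f i C ts, t => .func f (fun j => if h : j = i then C.fill t else ts ⟨j, h⟩)

/-- The position of the hole of a context. -/
def Context.holePos : Context L V → Position
  | .hole => []
  | .app _ i C _ => (i : ℕ) :: C.holePos

/-- A rewrite rule is a pair of terms (without any variable condition). -/
structure Rule (L : FirstOrder.Language.{u, v}) (V : Type w) where
  lhs : L.Term V
  rhs : L.Term V

/-- A rule is duplicating if some variable occurs more often on the right than on the left. -/
def Rule.Duplicating (ρ : Rule L V) : Prop := ∃ x, occ x ρ.lhs < occ x ρ.rhs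

/-- A term rewrite system over the signature `L`. -/
abbrev System (L : FirstOrder.Language.{u, v}) (V : Type w) := Set (Rule L V)

def LeftLinear (R : System L V) : Prop := ∀ ρ ∈ R, LinearTerm ρ.lhs

/-- The duplicating rules of `R`. -/
def dupRules (R : System L V) : System L V := {ρ ∈ R | ρ.Duplicating}

/-- The non-duplicating rules of `R`. -/
def nonDupRules (R : System L V) : System L V := {ρ ∈ R | ¬ ρ.Duplicating}

/-- Redex patterns `⟨p, l → r, σ⟩`. -/
structure Redex (L : FirstOrder.Language.{u, v}) (V : Type w) where
  pos : Position
  rule : Rule L V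
  sub : V → L.Term V

/-- The redex pattern `C[πσ] = ⟨qp, l → r, τσ⟩`, where `π = ⟨p, l → r, τ⟩` and `q` is the
position of the hole of `C`. -/
def Redex.lift (C : Context L V) (σ : V → L.Term V) (π : Redex L V) : Redex L V where
  pos := C.holePos ++ π.pos
  rule := π.rule
  sub := fun x => (π.sub x).subst σ

/-- `s →^π t` in the system `R`. -/
def IsStep (R : System L V) (s : L.Term V) (π : Redex L V) (t : L.Term V) : Prop :=
  π.rule ∈ R ∧ subtermAt s π.pos = some (π.rule.lhs.subst π.sub) ∧
    t = replaceAt s π.pos (π.rule.rhs.subst π.sub)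

/-- The rewrite relation `→_R`. -/
def Rewrites (R : System L V) (s t : L.Term V) : Prop := ∃ π, IsStep R s π t

/-- The relative rewrite relation `→_{R/S} = →_S^* · →_R · →_S^*`. -/
def RelRewrites (R S : System L V) (s t : L.Term V) : Prop :=
  ∃ s' t', Relation.ReflTransGen (Rewrites S) s s' ∧ Rewrites R s' t' ∧
    Relation.ReflTransGen (Rewrites S) t' t

/-- `R` terminates relative to `S`: there is no infinite sequence `s₀ →_{R/S} s₁ →_{R/S} ⋯`. -/
def RelTerminating (R S : System L V) : Prop := WellFounded (fun t s => RelRewrites R S s t)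

/-! Rewrite steps are closed under contexts and substitutions. -/

theorem subst_subst (t : L.Term V) (σ τ : V → L.Term V) :
    (t.subst σ).subst τ = t.subst (fun x => (σ x).subst τ) := by
  induction t with
  | var x => rfl
  | func f ts ih => simp only [FirstOrder.Language.Term.subst, ih]

theorem subtermAt_subst (σ : V → L.Term V) (p : Position) : ∀ (t u : L.Term V),
    subtermAt t p = some u → subtermAt (t.subst σ) p = some (u.subst σ) := by
  induction p with
  | nil => intro t u h; simp_all [subtermAt]
  | cons i p ih =>
    intro t u h
    cases t with
    | var x => simp [subtermAt] at h
    | @func n f ts =>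
      by_cases hi : i < n
      · simp only [subtermAt, hi, dite_true, FirstOrder.Language.Term.subst] at h ⊢
        exact ih _ _ h
      · simp [subtermAt, hi] at h

theorem replaceAt_subst (σ : V → L.Term V) (w : L.Term V) (p : Position) : ∀ (t u : L.Term V),
    subtermAt t p = some u →
      (replaceAt t p w).subst σ = replaceAt (t.subst σ) p (w.subst σ) := by
  induction p with
  | nil => intro t u _; simp [replaceAt]
  | cons i p ih =>
    intro t u h
    cases t with
    | var x => simp [subtermAt] at h
    | @func n f ts =>
      by_cases hi : i < n
      · simp only [subtermAt, hi, dite_true] at h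
        simp only [replaceAt, FirstOrder.Language.Term.subst]
        congr 1
        funext j
        by_cases hj : (j : ℕ) = i
        · subst hj
          simp only [if_true]
          exact ih _ _ h
        · simp [hj]
      · simp [subtermAt, hi] at h

theorem subtermAt_fill (C : Context L V) (t : L.Term V) (p : Position) :
    subtermAt (C.fill t) (C.holePos ++ p) = subtermAt t p := by
  induction C with
  | hole => rfl
  | app f i C ts ih => simp [Context.fill, Context.holePos, subtermAt, ih]

theorem replaceAt_fill (C : Context L V) (t w : L.Term V) (p : Position) :
    replaceAt (C.fill t) (C.holePos ++ p) w = C.fill (replaceAt t p w) := by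
  induction C with
  | hole => rfl
  | app f i C ts ih =>
    simp only [Context.fill, Context.holePos, List.cons_append, replaceAt]
    congr 1
    funext j
    by_cases hj : j = i
    · subst hj; simp [ih]
    · simp [hj, Fin.val_inj]

theorem IsStep.lift {R : System L V} {s t : L.Term V} {π : Redex L V} (h : IsStep R s π t)
    (C : Context L V) (σ : V → L.Term V) :
    IsStep R (C.fill (s.subst σ)) (π.lift C σ) (C.fill (t.subst σ)) := by
  obtain ⟨h1, h2, h3⟩ := h
  refine ⟨h1, ?_, ?_⟩
  · simp only [Redex.lift]
    rw [subtermAt_fill, subtermAt_subst σ _ _ _ h2, subst_subst]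
  · simp only [Redex.lift]
    rw [replaceAt_fill, h3, replaceAt_subst σ _ _ _ _ h2, subst_subst]

/-! Rewrite steps with full information, conversions, labelings. -/

/-- A rewrite step `s →^π t` of `R`. -/
structure Step (R : System L V) where
  source : L.Term V
  redex : Redex L V
  target : L.Term V
  isStep : IsStep R source redex target

/-- The rewrite step `C[sσ] →^{C[πσ]} C[tσ]` obtained from the rewrite step `s →^π t`. -/
def Step.lift {R : System L V} (C : Context L V) (σ : V → L.Term V) (a : Step R) : Step R where
  source := C.fill (a.source.subst σ)
  redex := a.redex.lift C σ
  target := C.fill (a.target.subst σ)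
  isStep := a.isStep.lift C σ

/-- A rewrite step together with the direction in which it is read. -/
inductive DirStep (R : System L V)
  /-- `s →^π t` -/
  | fwd (a : Step R) : DirStep R
  /-- `t ←^π s` -/
  | bwd (a : Step R) : DirStep R

/-- The underlying rewrite step. -/
def DirStep.step {R : System L V} : DirStep R → Step R
  | .fwd a => a
  | .bwd a => a

/-- The term on the left: `s` for `s →^π t`, and `t` for `t ←^π s`. -/
def DirStep.first {R : System L V} : DirStep R → L.Term V
  | .fwd a => a.source
  | .bwd a => a.target

/-- The term on the right: `t` for `s →^π t`, and `s` for `t ←^π s`. -/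
def DirStep.last {R : System L V} : DirStep R → L.Term V
  | .fwd a => a.target
  | .bwd a => a.source

def DirStep.IsFwd {R : System L V} (d : DirStep R) : Prop := ∃ a, d = .fwd a

def DirStep.IsBwd {R : System L V} (d : DirStep R) : Prop := ∃ a, d = .bwd a

/-- `ds` is a conversion from `s` to `t`. -/
def IsConversion {R : System L V} : L.Term V → List (DirStep R) → L.Term V → Prop
  | s, [], t => s = t
  | s, d :: ds, t => d.first = s ∧ IsConversion d.last ds t

/-- The set of labels of a conversion. -/
def labels {R : System L V} {A : Type z} (ℓ : DirStep R → A) (ds : List (DirStep R)) : Set A :=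
  {α | ∃ d ∈ ds, ℓ d = α}

/-- The set of all `β` that are below some element of `S`. -/
def below {A : Type z} (r : A → A → Prop) (S : Set A) : Set A := {β | ∃ α ∈ S, r α β}

/-- `ℓ` is a labeling, with respect to the relations `gt` and `ge` that compare labels. -/
structure IsLabeling {R : System L V} {A : Type z} (gt ge : A → A → Prop)
    (ℓ : DirStep R → A) : Prop where
  gt_lift : ∀ (a b : Step R) (C : Context L V) (σ : V → L.Term V),
    gt (ℓ (.fwd a)) (ℓ (.fwd b)) → gt (ℓ (.fwd (a.lift C σ))) (ℓ (.fwd (b.lift C σ)))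
  ge_lift : ∀ (a b : Step R) (C : Context L V) (σ : V → L.Term V),
    ge (ℓ (.fwd a)) (ℓ (.fwd b)) → ge (ℓ (.fwd (a.lift C σ))) (ℓ (.fwd (b.lift C σ)))
  fwd_eq_bwd : ∀ a : Step R, ℓ (.fwd a) = ℓ (.bwd a)

/-- The steps `a : s → t` and `b : s → u` form a local peak `t ← s → u`. -/
def IsPeak {R : System L V} (a b : Step R) : Prop := a.source = b.source

/-- A local peak with parallel redex positions. -/
def IsParallelPeak {R : System L V} (a b : Step R) : Prop :=
  IsPeak a b ∧ ParallelPos a.redex.pos b.redex.pos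

/-- A local peak in which the redex of `a` is at or below a variable position of the left-hand
side of the rule applied in `b`. -/
def IsVariablePeak {R : System L V} (a b : Step R) : Prop :=
  IsPeak a b ∧ ∃ q' : Position,
    b.redex.pos ++ q' = a.redex.pos ∧ q' ∉ funPos b.redex.rule.lhs

/-- The local peak `t ← s → u` of `a : s → t` and `b : s → u` is extended locally decreasing:
there is `t ↔* t' →⁼ t'' ↔* u'' ⁼← u' ↔* u` with suitably small labels. -/
def ExtLocallyDecreasing {R : System L V} {A : Type z} (gt ge : A → A → Prop)
    (ℓ : DirStep R → A) (a b : Step R) : Prop :=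
  ∃ (t' t'' u'' u' : L.Term V) (c₁ d₁ c₂ d₂ c₃ : List (DirStep R)),
    (IsConversion a.target c₁ t' ∧ labels ℓ c₁ ⊆ below gt {ℓ (.bwd a)}) ∧
    (IsConversion t' d₁ t'' ∧ d₁.length ≤ 1 ∧ (∀ d ∈ d₁, d.IsFwd) ∧
      labels ℓ d₁ ⊆ below ge {ℓ (.fwd b)}) ∧
    (IsConversion t'' c₂ u'' ∧ labels ℓ c₂ ⊆ below gt {ℓ (.bwd a), ℓ (.fwd b)}) ∧
    (IsConversion u'' d₂ u' ∧ d₂.length ≤ 1 ∧ (∀ d ∈ d₂, d.IsBwd) ∧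
      labels ℓ d₂ ⊆ below ge {ℓ (.bwd a)}) ∧
    (IsConversion u' c₃ b.target ∧ labels ℓ c₃ ⊆ below gt {ℓ (.fwd b)})

/-- `ℓ` is compatible with `R`. -/
def IsCompatible {R : System L V} {A : Type z} (gt ge : A → A → Prop)
    (ℓ : DirStep R → A) : Prop :=
  ∀ a b : Step R, IsParallelPeak a b ∨ IsVariablePeak a b → ExtLocallyDecreasing gt ge ℓ a b

/-- The local peak `t ← s → u` of `a : s → t` and `b : s → u` is weakly extended locally
decreasing: there is `t → v ⁿ← u`, where the label of `t → v` is at most that of `b`, the labels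
of `v ⁿ← u` are at most that of `a`, and `n ≤ 1` if the right-hand side of the rule applied in
`b` is linear. -/
def WeakExtLocallyDecreasing {R : System L V} {A : Type z} (ge : A → A → Prop)
    (ℓ : DirStep R → A) (a b : Step R) : Prop :=
  ∃ (c : Step R) (ds : List (DirStep R)),
    c.source = a.target ∧ ℓ (.fwd c) ∈ below ge {ℓ (.fwd b)} ∧
    IsConversion c.target ds b.target ∧ (∀ d ∈ ds, d.IsBwd) ∧
    labels ℓ ds ⊆ below ge {ℓ (.bwd a)} ∧
    (LinearTerm b.redex.rule.rhs → ds.length ≤ 1)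

/-- `ℓ` is weakly compatible with `R`. -/
def IsWeaklyCompatible {R : System L V} {A : Type z} (ge : A → A → Prop)
    (ℓ : DirStep R → A) : Prop :=
  ∀ a b : Step R, IsParallelPeak a b ∨ IsVariablePeak a b → WeakExtLocallyDecreasing ge ℓ a b

/-- `gt` is a well-founded order, `ge` is a preorder, and the two are compatible, that is,
`ge · gt · ge ⊆ gt`. -/
structure IsOrderPair {A : Type z} (gt ge : A → A → Prop) : Prop where
  wf : WellFounded (fun β α => gt α β)
  gt_trans : ∀ α β γ, gt α β → gt β γ → gt α γ
  ge_refl : ∀ α, ge α α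
  ge_trans : ∀ α β γ, ge α β → ge β γ → ge α γ
  compat : ∀ α β γ δ, ge α β → gt β γ → ge γ δ → gt α δ

/-- The source labeling. -/
def srcLabeling (R : System L V) (d : DirStep R) : L.Term V := d.step.source

/-- The strict relation of the source labeling: `→_{R_d/R_nd}^+`. -/
def srcGt (R : System L V) : L.Term V → L.Term V → Prop :=
  Relation.TransGen (RelRewrites (dupRules R) (nonDupRules R))

/-- The weak relation of the source labeling: `→_R^*`. -/
def srcGe (R : System L V) : L.Term V → L.Term V → Prop := Relation.ReflTransGen (Rewrites R)

/-- The strict part of the lexicographic combination of `(gt₁, ge₁)` and `(gt₂, ge₂)`. -/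
def lexGt {A B : Type*} (gt₁ ge₁ : A → A → Prop) (gt₂ : B → B → Prop) (α β : A × B) : Prop :=
  gt₁ α.1 β.1 ∨ (ge₁ α.1 β.1 ∧ gt₂ α.2 β.2)

/-- The weak part of the lexicographic combination of `(gt₁, ge₁)` and `(gt₂, ge₂)`. -/
def lexGe {A B : Type*} (gt₁ ge₁ : A → A → Prop) (ge₂ : B → B → Prop) (α β : A × B) : Prop :=
  gt₁ α.1 β.1 ∨ (ge₁ α.1 β.1 ∧ ge₂ α.2 β.2)

/-- The labeling `ℓ^src × ℓ`. -/
def srcLex {R : System L V} {A : Type z} (ℓ : DirStep R → A) (d : DirStep R) : L.Term V × A :=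
  (srcLabeling R d, ℓ d)

end TRS

namespace TRS

variable {L : FirstOrder.Language.{u, v}} {V : Type w}

/-! For the peak `t ← s → u`, weak compatibility supplies a join `t → v` and `u →ⁿ v`. All sources
of its steps are reachable from `s`, so comparing sources never spoils a weak inequality between
labels under `ℓ`. Hence `t → v` fits the second part of the required conversion. If the right-hand
side `r₂` is linear, then `n ≤ 1` and `v ←⁼ u` fits the fourth part. If `r₂` is not linear, some
variable occurs at least twice in it but at most once in the left-hand side, by left-linearity. The
rule is then duplicating, every source in `u →ⁿ v` is strictly below `s`, and all `n` steps fit the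
last part, whatever their labels under `ℓ`. The labeling property holds because both source
relations are closed under contexts and substitutions. The order properties rest on `→_R` steps
being absorbed by `srcGt` on either side, with relative termination giving well-foundedness. -/

theorem LinearTerm.of_occ_le {s t : L.Term V} (hs : LinearTerm s) (h : ∀ x, occ x t ≤ occ x s) :
    LinearTerm t :=
  fun x => (h x).trans (hs x)

/-! ### Closure of the source relations under contexts and substitutions -/

theorem Rewrites.lift {R : System L V} {s t : L.Term V} (h : Rewrites R s t) (C : Context L V)
    (σ : V → L.Term V) : Rewrites R (C.fill (s.subst σ)) (C.fill (t.subst σ)) :=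
  let ⟨π, hπ⟩ := h
  ⟨π.lift C σ, hπ.lift C σ⟩

theorem reflTransGen_rewrites_lift {R : System L V} {s t : L.Term V}
    (h : Relation.ReflTransGen (Rewrites R) s t) (C : Context L V) (σ : V → L.Term V) :
    Relation.ReflTransGen (Rewrites R) (C.fill (s.subst σ)) (C.fill (t.subst σ)) := by
  induction h with
  | refl => exact .refl
  | tail _ h ih => exact ih.tail (h.lift C σ)

theorem RelRewrites.lift {R S : System L V} {s t : L.Term V} (h : RelRewrites R S s t)
    (C : Context L V) (σ : V → L.Term V) :
    RelRewrites R S (C.fill (s.subst σ)) (C.fill (t.subst σ)) :=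
  let ⟨_, _, h1, h2, h3⟩ := h
  ⟨_, _, reflTransGen_rewrites_lift h1 C σ, h2.lift C σ, reflTransGen_rewrites_lift h3 C σ⟩

theorem srcGt_lift {R : System L V} {s t : L.Term V} (h : srcGt R s t) (C : Context L V)
    (σ : V → L.Term V) : srcGt R (C.fill (s.subst σ)) (C.fill (t.subst σ)) := by
  induction h with
  | single h => exact .single (h.lift C σ)
  | tail _ h ih => exact ih.tail (h.lift C σ)

/-! ### Order properties of the source relations and of the lexicographic combination -/

theorem srcGt_trans {R : System L V} {s t u : L.Term V} (h : srcGt R s t) (h' : srcGt R t u) :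
    srcGt R s u :=
  Relation.TransGen.trans h h'

theorem srcGe_trans {R : System L V} {s t u : L.Term V} (h : srcGe R s t) (h' : srcGe R t u) :
    srcGe R s u :=
  Relation.ReflTransGen.trans h h'

theorem Rewrites.dup_or_nonDup {R : System L V} {s t : L.Term V} (h : Rewrites R s t) :
    Rewrites (dupRules R) s t ∨ Rewrites (nonDupRules R) s t := by
  obtain ⟨π, h1, h2⟩ := h
  by_cases hd : π.rule.Duplicating
  · exact .inl ⟨π, ⟨h1, hd⟩, h2⟩
  · exact .inr ⟨π, ⟨h1, hd⟩, h2⟩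

theorem Rewrites.srcGt {R : System L V} {s t : L.Term V} (h : Rewrites (dupRules R) s t) :
    srcGt R s t :=
  .single ⟨s, t, .refl, h, .refl⟩

/-- A duplicating step is itself a relative step and lengthens the chain; a non-duplicating one is
absorbed by the `→_{R_nd}^*` prefix of the first relative step. -/
theorem srcGt_of_rewrites_of_srcGt {R : System L V} {s t u : L.Term V} (h : Rewrites R s t)
    (h' : srcGt R t u) : srcGt R s u := by
  rcases h.dup_or_nonDup with hd | hn
  · exact srcGt_trans hd.srcGt h'
  · rcases Relation.TransGen.head'_iff.1 h' with ⟨v, ⟨t', v', h1, h2, h3⟩, hv⟩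
    exact Relation.TransGen.head'_iff.2 ⟨v, ⟨t', v', .head hn h1, h2, h3⟩, hv⟩

theorem srcGt_of_srcGt_of_rewrites {R : System L V} {s t u : L.Term V} (h : srcGt R s t)
    (h' : Rewrites R t u) : srcGt R s u := by
  rcases h'.dup_or_nonDup with hd | hn
  · exact srcGt_trans h hd.srcGt
  · rcases Relation.TransGen.tail'_iff.1 h with ⟨v, hv, t', v', h1, h2, h3⟩
    exact Relation.TransGen.tail'_iff.2 ⟨v, hv, t', v', h1, h2, h3.tail hn⟩

theorem srcGt_of_srcGe_of_srcGt {R : System L V} {s t u : L.Term V} (h : srcGe R s t)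
    (h' : srcGt R t u) : srcGt R s u := by
  induction h using Relation.ReflTransGen.head_induction_on with
  | refl => exact h'
  | head h _ ih => exact srcGt_of_rewrites_of_srcGt h ih

theorem srcGt_of_srcGt_of_srcGe {R : System L V} {s t u : L.Term V} (h : srcGt R s t)
    (h' : srcGe R t u) : srcGt R s u := by
  induction h' with
  | refl => exact h
  | tail _ h' ih => exact srcGt_of_srcGt_of_rewrites ih h'

/-- The source labeling comes with an order pair. -/
theorem isOrderPair_src {R : System L V}
    (hterm : RelTerminating (dupRules R) (nonDupRules R)) :
    IsOrderPair (srcGt R) (srcGe R) where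
  wf := by
    have h := WellFounded.transGen hterm
    refine Subrelation.wf (fun {t s} hst => ?_) h
    exact Relation.transGen_swap.1 hst
  gt_trans _ _ _ := srcGt_trans
  ge_refl _ := .refl
  ge_trans _ _ _ := srcGe_trans
  compat _ _ _ _ h1 h2 h3 := srcGt_of_srcGt_of_srcGe (srcGt_of_srcGe_of_srcGt h1 h2) h3

/-- Lexicographic combinations of order pairs are order pairs. -/
theorem IsOrderPair.lex {A B : Type*} {gt₁ ge₁ : A → A → Prop} {gt₂ ge₂ : B → B → Prop}
    (h₁ : IsOrderPair gt₁ ge₁) (h₂ : IsOrderPair gt₂ ge₂) :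
    IsOrderPair (lexGt gt₁ ge₁ gt₂) (lexGe gt₁ ge₁ ge₂) where
  wf := by
    refine ⟨fun ⟨a, b⟩ => ?_⟩
    -- A weak step may change the first component without decreasing it strictly. So the outer
    -- induction fixes a bound `a` and the inner one, on `b`, ranges over all `a'` with `ge₁ a a'`;
    -- a strict step from `a'` is also strict from `a`.
    suffices ∀ a' b, ge₁ a a' → Acc (fun β α => lexGt gt₁ ge₁ gt₂ α β) (a', b) from
      this a b (h₁.ge_refl a)
    induction a using h₁.wf.induction with
    | _ a iha =>
      intro a' b
      induction b using h₂.wf.induction generalizing a' with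
      | _ b ihb =>
        intro haa'
        refine ⟨_, fun ⟨a'', b'⟩ h => ?_⟩
        rcases h with h | ⟨h, hb⟩
        · exact iha a'' (h₁.compat _ _ _ _ haa' h (h₁.ge_refl _)) a'' b' (h₁.ge_refl _)
        · exact ihb b' hb a'' (h₁.ge_trans _ _ _ haa' h)
  gt_trans := by
    rintro ⟨a, b⟩ ⟨a', b'⟩ ⟨a'', b''⟩ (h | ⟨h, hb⟩) (h' | ⟨h', hb'⟩)
    · exact .inl (h₁.gt_trans _ _ _ h h')
    · exact .inl (h₁.compat _ _ _ _ (h₁.ge_refl _) h h')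
    · exact .inl (h₁.compat _ _ _ _ h h' (h₁.ge_refl _))
    · exact .inr ⟨h₁.ge_trans _ _ _ h h', h₂.gt_trans _ _ _ hb hb'⟩
  ge_refl _ := .inr ⟨h₁.ge_refl _, h₂.ge_refl _⟩
  ge_trans := by
    rintro ⟨a, b⟩ ⟨a', b'⟩ ⟨a'', b''⟩ (h | ⟨h, hb⟩) (h' | ⟨h', hb'⟩)
    · exact .inl (h₁.gt_trans _ _ _ h h')
    · exact .inl (h₁.compat _ _ _ _ (h₁.ge_refl _) h h')
    · exact .inl (h₁.compat _ _ _ _ h h' (h₁.ge_refl _))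
    · exact .inr ⟨h₁.ge_trans _ _ _ h h', h₂.ge_trans _ _ _ hb hb'⟩
  compat := by
    have left : ∀ {x y z : A}, ge₁ x y → gt₁ y z → gt₁ x z :=
      fun h h' => h₁.compat _ _ _ _ h h' (h₁.ge_refl _)
    have right : ∀ {x y z : A}, gt₁ x y → ge₁ y z → gt₁ x z :=
      fun h h' => h₁.compat _ _ _ _ (h₁.ge_refl _) h h'
    rintro ⟨a, b⟩ ⟨a', b'⟩ ⟨a'', b''⟩ ⟨a''', b'''⟩ (h | ⟨h, hb⟩) (h' | ⟨h', hb'⟩) (k | ⟨k, kb⟩)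
    · exact .inl (h₁.gt_trans _ _ _ (h₁.gt_trans _ _ _ h h') k)
    · exact .inl (right (h₁.gt_trans _ _ _ h h') k)
    · exact .inl (h₁.gt_trans _ _ _ (right h h') k)
    · exact .inl (right (right h h') k)
    · exact .inl (h₁.gt_trans _ _ _ (left h h') k)
    · exact .inl (right (left h h') k)
    · exact .inl (left (h₁.ge_trans _ _ _ h h') k)
    · exact .inr ⟨h₁.ge_trans _ _ _ (h₁.ge_trans _ _ _ h h') k, h₂.compat _ _ _ _ hb hb' kb⟩

/-! ### Joining local peaks -/

theorem Step.rewrites {R : System L V} (a : Step R) : Rewrites R a.source a.target :=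
  ⟨a.redex, a.isStep⟩

/-- A step with a duplicating rule strictly decreases the source label. -/
theorem Step.srcGt_of_duplicating {R : System L V} (a : Step R) (h : a.redex.rule.Duplicating) :
    srcGt R a.source a.target :=
  Rewrites.srcGt ⟨a.redex, ⟨a.isStep.1, h⟩, a.isStep.2⟩

/-- In a left-linear system, rules with nonlinear right-hand sides are duplicating. -/
theorem LeftLinear.duplicating {R : System L V} (hR : LeftLinear R) {ρ : Rule L V} (hρ : ρ ∈ R)
    (h : ¬ LinearTerm ρ.rhs) : ρ.Duplicating := by
  by_contra hd
  exact h ((hR ρ hρ).of_occ_le fun x => not_lt.1 fun hx => hd ⟨x, hx⟩)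

/-- If `v ←^* u`, then all sources of the steps can be reached from `u`. -/
theorem IsConversion.srcGe_of_isBwd {R : System L V} {ds : List (DirStep R)} {v u : L.Term V}
    (h : IsConversion v ds u) (hds : ∀ d ∈ ds, d.IsBwd) :
    srcGe R u v ∧ ∀ d ∈ ds, srcGe R u d.step.source := by
  induction ds generalizing v with
  | nil => exact ⟨h ▸ .refl, by simp⟩
  | cons d ds ih =>
    obtain ⟨rfl, h⟩ := h
    obtain ⟨ih1, ih2⟩ := ih h fun e he => hds e (List.mem_cons_of_mem _ he)
    obtain ⟨a, rfl⟩ := hds d List.mem_cons_self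
    refine ⟨Relation.ReflTransGen.tail ih1 a.rewrites, fun e he => ?_⟩
    rcases List.mem_cons.1 he with rfl | he
    -- The source of a backward step is its right end, where the remaining conversion starts.
    · exact ih1
    · exact ih2 e he

/-- The lexicographic combination of the source labeling and a labeling is a labeling. -/
theorem IsLabeling.srcLex {R : System L V} {A : Type z} {gt ge : A → A → Prop}
    {ℓ : DirStep R → A} (h : IsLabeling gt ge ℓ) :
    IsLabeling (lexGt (srcGt R) (srcGe R) gt) (lexGe (srcGt R) (srcGe R) ge) (srcLex ℓ) where
  gt_lift a b C σ := Or.imp (fun h' => srcGt_lift h' C σ)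
    (And.imp (fun h' => reflTransGen_rewrites_lift h' C σ) (h.gt_lift a b C σ))
  ge_lift a b C σ := Or.imp (fun h' => srcGt_lift h' C σ)
    (And.imp (fun h' => reflTransGen_rewrites_lift h' C σ) (h.ge_lift a b C σ))
  fwd_eq_bwd a := Prod.ext rfl (h.fwd_eq_bwd a)

/-- Only the common source of the two steps matters here; the relative position of the redexes has
been used up in obtaining the weak join. -/
theorem WeakExtLocallyDecreasing.extLocallyDecreasing_srcLex {R : System L V}
    (hleft : LeftLinear R) {A : Type z} (gt : A → A → Prop) {ge : A → A → Prop}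
    {ℓ : DirStep R → A} {a b : Step R} (hab : IsPeak a b)
    (h : WeakExtLocallyDecreasing ge ℓ a b) :
    ExtLocallyDecreasing (lexGt (srcGt R) (srcGe R) gt) (lexGe (srcGt R) (srcGe R) ge)
      (srcLex ℓ) a b := by
  obtain ⟨c, ds, hc, hcl, hds, hbwd, hdl, hlin⟩ := h
  have hsrc := (hds.srcGe_of_isBwd hbwd).2
  have hd₁ : labels (srcLex ℓ) [.fwd c] ⊆
      below (lexGe (srcGt R) (srcGe R) ge) {srcLex ℓ (.fwd b)} := by
    rintro _ ⟨d, hd, rfl⟩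
    obtain rfl := List.mem_singleton.1 hd
    obtain ⟨_, rfl, hge⟩ := hcl
    refine ⟨_, rfl, .inr ⟨?_, hge⟩⟩
    change srcGe R b.source c.source
    rw [hc, ← hab]
    exact .single a.rewrites
  have hnil : ∀ S : Set (L.Term V × A), labels (srcLex ℓ) [] ⊆ S := by
    rintro S _ ⟨d, hd, -⟩
    simp at hd
  by_cases hr : LinearTerm b.redex.rule.rhs
  -- Linear case: `ds` has at most one step and is bounded weakly by the label of `a`.
  · refine ⟨a.target, c.target, c.target, b.target, [], [.fwd c], [], ds, [], ⟨rfl, hnil _⟩,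
      ⟨⟨hc, rfl⟩, le_rfl, by simp [DirStep.IsFwd], hd₁⟩, ⟨rfl, hnil _⟩,
      ⟨hds, hlin hr, hbwd, ?_⟩, ⟨rfl, hnil _⟩⟩
    rintro _ ⟨d, hd, rfl⟩
    obtain ⟨_, rfl, hge⟩ := hdl ⟨d, hd, rfl⟩
    refine ⟨_, rfl, .inr ⟨?_, hge⟩⟩
    change srcGe R a.source d.step.source
    rw [show a.source = b.source from hab]
    exact .head b.rewrites (hsrc d hd)
  -- Nonlinear case: `ds` may be long, so it becomes the last part, strictly below the label of `b`
  -- by its sources alone.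
  · refine ⟨a.target, c.target, c.target, c.target, [], [.fwd c], [], [], ds, ⟨rfl, hnil _⟩,
      ⟨⟨hc, rfl⟩, le_rfl, by simp [DirStep.IsFwd], hd₁⟩, ⟨rfl, hnil _⟩,
      ⟨rfl, by simp, by simp, hnil _⟩, ⟨hds, ?_⟩⟩
    rintro _ ⟨d, hd, rfl⟩
    exact ⟨_, rfl, .inl (srcGt_of_srcGt_of_srcGe
      (b.srcGt_of_duplicating (hleft.duplicating b.isStep.1 hr)) (hsrc d hd))⟩

/-- Weak compatibility of `ℓ` implies compatibility of its combination with the source labeling. -/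
theorem IsWeaklyCompatible.isCompatible_srcLex {R : System L V} (hleft : LeftLinear R)
    {A : Type z} (gt : A → A → Prop) {ge : A → A → Prop} {ℓ : DirStep R → A}
    (h : IsWeaklyCompatible ge ℓ) :
    IsCompatible (lexGt (srcGt R) (srcGe R) gt) (lexGe (srcGt R) (srcGe R) ge) (srcLex ℓ) :=
  fun a b hab => (h a b hab).extLocallyDecreasing_srcLex hleft gt
    (hab.elim And.left And.left)

end TRS

theorem mainTheorem7 {L : FirstOrder.Language.{u, v}} {V : Type w} (R : TRS.System L V)
    (hleft : TRS.LeftLinear R)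
    (hterm : TRS.RelTerminating (TRS.dupRules R) (TRS.nonDupRules R))
    {A : Type z} (gt ge : A → A → Prop) (ℓ : TRS.DirStep R → A)
    (hlab : TRS.IsLabeling gt ge ℓ) (hweak : TRS.IsWeaklyCompatible ge ℓ) :
    TRS.IsLabeling
      (TRS.lexGt (TRS.srcGt R) (TRS.srcGe R) gt) (TRS.lexGe (TRS.srcGt R) (TRS.srcGe R) ge)
      (TRS.srcLex ℓ) ∧
    TRS.IsCompatible
      (TRS.lexGt (TRS.srcGt R) (TRS.srcGe R) gt) (TRS.lexGe (TRS.srcGt R) (TRS.srcGe R) ge)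
      (TRS.srcLex ℓ) ∧
    (TRS.IsOrderPair gt ge →
      TRS.IsOrderPair
        (TRS.lexGt (TRS.srcGt R) (TRS.srcGe R) gt)
        (TRS.lexGe (TRS.srcGt R) (TRS.srcGe R) ge)) :=
  ⟨hlab.srcLex, hweak.isCompatible_srcLex hleft gt,
    fun h => (TRS.isOrderPair_src hterm).lex h⟩
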